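/- Let $(M,g_M)$ be a connected, complete, smooth, finite-dimensional Riemannian manifold, let $r_M(x)=\operatorname{dist}_M(o_M,x)$ be the distance from a fixed point $o_M\in M$, and consider the Lorentzian product $\overline M=M\times\mathbb R$, $\overline g=g_M-dt^2$. Let $u:M\to\mathbb R$ be a smooth function whose graph $\Sigma=\{(x,u(x)):x\in M\}$ is a spacelike hypersurface of $(\overline M,\overline g)$, that is, the metric $g$ induced on $\Sigma$ by $\overline g$ is positive definite. Let $\nu$ be the future-pointing unit normal of $\Sigma$ (so $\overline g(\nu,\nu)=-1$, $\nu\perp T\Sigma$ and $\overline g(\nu,\partial_t)<0$), let $\nu_M$ be its orthogonal projection onto $TM$, and write $|\nu_M|(x)$ for the $g_M$-norm of $\nu_M$ at the point $(x,u(x))$. Suppose that $$|\nu_M|(x)\le G(r_M(x))\qquad\text{for all }x\in M,$$ for some continuous function $G:[0,\infty)\to\mathbb R$ such that (a) $G>0$, (b) $\int_0^\infty \frac{dr}{G(r)}=\infty$, and (c) $G$ is nondecreasing. Then the Riemannian manifold $(\Sigma,g)$ is complete, i.e. complete for its Riemannian distance. -/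

import Mathlib

open Set Filter MeasureTheory Bundle
open scoped Manifold ContDiff Topology ENNReal

noncomputable section

namespace LorentzProduct

section Distance

variable {E : Type*} [NormedAddCommGroup E] [NormedSpace ℝ E]
  {N : Type*} [TopologicalSpace N] [ChartedSpace E N]

/-- The distance of a Riemannian metric `g` on `N` (a family of bilinear forms on the tangent
spaces): the infimum over `C^1` paths from `x` to `y` of the length `∫ √(g(γ', γ'))`, that is,
Mathlib's Riemannian distance for the norms `v ↦ √(g x v v)` on the tangent spaces. -/
def metricEDist (g : ∀ x : N, TangentSpace 𝓘(ℝ, E) x → TangentSpace 𝓘(ℝ, E) x → ℝ)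
    (x y : N) : ℝ≥0∞ :=
  letI : ∀ z : N, ENorm (TangentSpace 𝓘(ℝ, E) z) :=
    fun z => ⟨fun v => ENNReal.ofReal (Real.sqrt (g z v v))⟩
  Manifold.riemannianEDist 𝓘(ℝ, E) x y

/-- `(N, g)` is complete: every Cauchy sequence for the Riemannian distance of `g` converges for
that distance. -/
def IsMetricComplete
    (g : ∀ x : N, TangentSpace 𝓘(ℝ, E) x → TangentSpace 𝓘(ℝ, E) x → ℝ) : Prop :=
  ∀ s : ℕ → N,
    (∀ ε : ℝ≥0∞, 0 < ε → ∃ K : ℕ, ∀ m ≥ K, ∀ n ≥ K, metricEDist g (s m) (s n) < ε) →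
      ∃ x : N, Tendsto (fun n => metricEDist g (s n) x) atTop (𝓝 0)

end Distance

section Product

variable {E : Type*} [NormedAddCommGroup E] [NormedSpace ℝ E]
  {M : Type*} [TopologicalSpace M] [ChartedSpace E M]

/-- The tangent space of the product manifold `M × ℝ` at `p`. -/
abbrev TangentProd (E : Type*) [NormedAddCommGroup E] [NormedSpace ℝ E]
    {M : Type*} [TopologicalSpace M] [ChartedSpace E M] (p : M × ℝ) : Type _ :=
  TangentSpace (𝓘(ℝ, E).prod 𝓘(ℝ, ℝ)) p

/-- The component tangent to `M` of a vector tangent to `M × ℝ`: the differential of the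
projection `M × ℝ → M`. -/
def projM (p : M × ℝ) : TangentProd E p →L[ℝ] TangentSpace 𝓘(ℝ, E) p.1 :=
  mfderiv (𝓘(ℝ, E).prod 𝓘(ℝ, ℝ)) 𝓘(ℝ, E) Prod.fst p

/-- The one-form `dt` on `M × ℝ`: the differential of the projection `M × ℝ → ℝ`. -/
def dt (p : M × ℝ) : TangentProd E p →L[ℝ] ℝ :=
  mfderiv (𝓘(ℝ, E).prod 𝓘(ℝ, ℝ)) 𝓘(ℝ, ℝ) Prod.snd p

/-- The vector field `∂_t` on `M × ℝ`: the velocity of `s ↦ (p.1, s)`. -/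
def partialT (p : M × ℝ) : TangentProd E p :=
  mfderiv 𝓘(ℝ, ℝ) (𝓘(ℝ, E).prod 𝓘(ℝ, ℝ)) (fun s : ℝ => (p.1, s)) p.2 (1 : ℝ)

variable [RiemannianBundle (fun x : M => TangentSpace 𝓘(ℝ, E) x)]

/-- The Lorentzian product metric `g_M - dt²` on `M × ℝ`. -/
def lorentz (p : M × ℝ) (v w : TangentProd E p) : ℝ :=
  inner ℝ (projM p v) (projM p w) - dt p v * dt p w

variable {E' : Type*} [NormedAddCommGroup E'] [NormedSpace ℝ E']
  {N : Type*} [TopologicalSpace N] [ChartedSpace E' N]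

/-- The differential of a map `F : N → M × ℝ`. -/
def differential (E : Type*) [NormedAddCommGroup E] [NormedSpace ℝ E]
    {M : Type*} [TopologicalSpace M] [ChartedSpace E M]
    {E' : Type*} [NormedAddCommGroup E'] [NormedSpace ℝ E']
    {N : Type*} [TopologicalSpace N] [ChartedSpace E' N]
    (F : N → M × ℝ) (x : N) : TangentSpace 𝓘(ℝ, E') x →L[ℝ] TangentProd E (F x) :=
  mfderiv 𝓘(ℝ, E') (𝓘(ℝ, E).prod 𝓘(ℝ, ℝ)) F x

/-- The metric `F^*(g_M - dt²)` that `F : N → M × ℝ` induces on `N`. -/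
def inducedMetric (F : N → M × ℝ) (x : N) (v w : TangentSpace 𝓘(ℝ, E') x) : ℝ :=
  lorentz (F x) (differential E F x v) (differential E F x w)

/-- `F : N → M × ℝ` is spacelike: the induced metric is positive definite. -/
def IsSpacelike (F : N → M × ℝ) : Prop :=
  ∀ (x : N) (v : TangentSpace 𝓘(ℝ, E') x), v ≠ 0 → 0 < inducedMetric (E := E) F x v v

/-- `ν` is a future-directed unit timelike normal vector field along `F`. -/
structure IsFutureUnitNormal (F : N → M × ℝ) (ν : ∀ x : N, TangentProd E (F x)) : Prop where
  normal : ∀ (x : N) (v : TangentSpace 𝓘(ℝ, E') x),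
    lorentz (F x) (ν x) (differential E F x v) = 0
  unit : ∀ x : N, lorentz (F x) (ν x) (ν x) = -1
  future : ∀ x : N, lorentz (F x) (ν x) (partialT (F x)) < 0

end Product

/-- The embedding `x ↦ (x, u x)` of `M` onto the graph of `u`. The graph is a manifold through
this parametrization, whose inverse is the restriction of the projection `M × ℝ → M`. -/
def graphMap {M : Type*} (u : M → ℝ) (x : M) : M × ℝ := (x, u x)

end LorentzProduct

end

namespace LorentzProduct

/-! Pulled back to $M$, the induced metric is $g = g_M - du^2 \le g_M$. Conversely, Cauchy–Schwarz
against $\nu$ gives $|v|^2 \le (1+|\nu_M|^2)\,g(v,v)$ (`norm_sq_le_of_unit_timelike_orthogonal`), so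
$\sqrt{g(v,v)} \ge \varphi(r_M)|v|$ with $\varphi = 1/(CG)$ nonincreasing and of infinite integral.
Along a path from $x$, $r_M$ is at most $r_M(x)$ plus the $g_M$-arc length, so the $g$-length is at
least the integral of $\varphi$ over $[r_M(x), r_M(x)+d(x,y)]$ (`lintegral_le_metricEDist`).
Divergence then makes $g$-Cauchy sequences $g_M$-bounded, hence $g_M$-Cauchy, and their $g_M$-limits
are also $g$-limits. -/

theorem lintegral_Icc_add_integral (f : ℝ → ℝ) (hf : ContinuousOn f (Icc 0 1))
    (hf0 : ∀ t ∈ Icc (0 : ℝ) 1, 0 ≤ f t) (h : ℝ → ℝ≥0∞) (a : ℝ) :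
    ∫⁻ s in Icc a (a + ∫ t in (0 : ℝ)..1, f t), h s =
      ∫⁻ t in Icc (0 : ℝ) 1, ENNReal.ofReal (f t) * h (a + ∫ s in (0 : ℝ)..t, f s) := by
  set ρ : ℝ → ℝ := fun t => a + ∫ s in (0 : ℝ)..t, f s with hρ
  have hint : ∀ t ∈ Icc (0 : ℝ) 1, ∀ t' ∈ Icc (0 : ℝ) 1, IntervalIntegrable f volume t t' :=
    fun t ht t' ht' => (hf.mono (ordConnected_Icc.uIcc_subset ht ht')).intervalIntegrable
  have h0 : (0 : ℝ) ∈ Icc (0 : ℝ) 1 := by simp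
  have hderiv : ∀ t ∈ Icc (0 : ℝ) 1, HasDerivWithinAt ρ (f t) (Icc 0 1) t := by
    intro t ht
    have : Fact (t ∈ Icc (0 : ℝ) 1) := ⟨ht⟩
    exact (intervalIntegral.integral_hasDerivWithinAt_right (hint 0 h0 t ht)
      (hf.stronglyMeasurableAtFilter_nhdsWithin measurableSet_Icc t) (hf t ht)).const_add a
  have hmono : MonotoneOn ρ (Icc 0 1) := by
    intro t ht t' ht' htt'
    have h1 : 0 ≤ ∫ s in t..t', f s := intervalIntegral.integral_nonneg htt'
      fun s hs => hf0 s ⟨ht.1.trans hs.1, hs.2.trans ht'.2⟩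
    have h2 := intervalIntegral.integral_add_adjacent_intervals (hint 0 h0 t ht)
      (hint t ht t' ht')
    simp only [hρ]
    linarith
  have himg : ρ '' Icc 0 1 = Icc a (a + ∫ t in (0 : ℝ)..1, f t) := by
    rw [ContinuousOn.image_Icc_of_monotoneOn zero_le_one
      (fun t ht => (hderiv t ht).continuousWithinAt) hmono]
    simp [hρ]
  rw [← himg]
  -- `f` may vanish, so `ρ` is only weakly monotone; this change of variables does not need
  -- injectivity.
  exact lintegral_image_eq_lintegral_deriv_mul_of_monotoneOn measurableSet_Icc hderiv hmono h

/-! ### Pointwise comparison of the induced metric with $g_M$ -/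

section
variable {E : Type*} [NormedAddCommGroup E] [NormedSpace ℝ E]
  {M : Type*} [TopologicalSpace M] [ChartedSpace E M]

theorem continuousOn_norm_mfderivWithin_one [IsManifold 𝓘(ℝ, E) 1 M]
    [RiemannianBundle (fun x : M => TangentSpace 𝓘(ℝ, E) x)]
    [IsContinuousRiemannianBundle E (fun x : M => TangentSpace 𝓘(ℝ, E) x)]
    {γ : ℝ → M} {s : Set ℝ} (hγ : ContMDiffOn 𝓘(ℝ, ℝ) 𝓘(ℝ, E) 1 γ s) (hs : UniqueDiffOn ℝ s) :
    ContinuousOn (fun t => ‖mfderivWithin 𝓘(ℝ, ℝ) 𝓘(ℝ, E) γ s t (1 : ℝ)‖) s := by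
  have h1 : ContinuousOn (fun t : ℝ => (TotalSpace.mk' E (γ t)
      (mfderivWithin 𝓘(ℝ, ℝ) 𝓘(ℝ, E) γ s t (1 : ℝ)) : TangentBundle 𝓘(ℝ, E) M)) s := by
    have h2 := hγ.continuousOn_tangentMapWithin le_rfl hs.uniqueMDiffOn
    have h3 : Continuous fun t : ℝ => (⟨t, (1 : ℝ)⟩ : TangentBundle 𝓘(ℝ, ℝ) ℝ) := by
      rw [← (tangentBundleModelSpaceHomeomorph 𝓘(ℝ, ℝ)).comp_continuous_iff]
      exact continuous_id.prodMk continuous_const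
    exact h2.comp h3.continuousOn fun t ht => ht
  have h4 := h1.inner_bundle h1
  simp_rw [norm_eq_sqrt_real_inner]
  exact h4.sqrt

theorem projM_differential_graphMap {u : M → ℝ} {x : M}
    (hu : MDifferentiableAt 𝓘(ℝ, E) 𝓘(ℝ, ℝ) u x) (v : TangentSpace 𝓘(ℝ, E) x) :
    projM (graphMap u x) (differential E (E' := E) (graphMap u) x v) = v := by
  have h1 : MDifferentiableAt 𝓘(ℝ, E) (𝓘(ℝ, E).prod 𝓘(ℝ, ℝ)) (graphMap u) x :=
    mdifferentiableAt_id.prodMk hu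
  have h2 := mfderiv_comp x
    (mdifferentiableAt_fst (I := 𝓘(ℝ, E)) (I' := 𝓘(ℝ, ℝ)) (x := graphMap u x)) h1
  have h3 : (Prod.fst ∘ graphMap u) = (id : M → M) := rfl
  rw [h3, mfderiv_id] at h2
  exact (DFunLike.congr_fun h2 v).symm

variable [RiemannianBundle (fun x : M => TangentSpace 𝓘(ℝ, E) x)]

theorem inducedMetric_graphMap_self {u : M → ℝ} {x : M}
    (hu : MDifferentiableAt 𝓘(ℝ, E) 𝓘(ℝ, ℝ) u x) (v : TangentSpace 𝓘(ℝ, E) x) :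
    inducedMetric (E := E) (E' := E) (graphMap u) x v v =
      inner ℝ v v - dt (graphMap u x) (differential E (E' := E) (graphMap u) x v) *
        dt (graphMap u x) (differential E (E' := E) (graphMap u) x v) := by
  unfold inducedMetric lorentz
  rw [projM_differential_graphMap hu]
  rfl

theorem sqrt_inducedMetric_graphMap_le_norm {u : M → ℝ} {x : M}
    (hu : MDifferentiableAt 𝓘(ℝ, E) 𝓘(ℝ, ℝ) u x) (v : TangentSpace 𝓘(ℝ, E) x) :
    √(inducedMetric (E := E) (E' := E) (graphMap u) x v v) ≤ ‖v‖ := by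
  rw [inducedMetric_graphMap_self hu, Real.sqrt_le_left (norm_nonneg v),
    real_inner_self_eq_norm_sq]
  exact sub_le_self _ (mul_self_nonneg _)

/-- Here `(n, a)` is the unit normal and `(v, b)` a tangent vector, split into space and time parts.
Since $a^2 = 1+|n|^2$ and $ab = \langle n,v\rangle$, Cauchy–Schwarz gives $a^2(|v|^2-b^2) \ge
(a^2-|n|^2)|v|^2 = |v|^2$. -/
theorem norm_sq_le_of_unit_timelike_orthogonal {V : Type*} [NormedAddCommGroup V]
    [InnerProductSpace ℝ V] {n v : V} {a b : ℝ} (horth : inner ℝ n v - a * b = 0)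
    (hunit : inner ℝ n n - a * a = -1) :
    ‖v‖ ^ 2 ≤ (1 + ‖n‖ ^ 2) * (inner ℝ v v - b * b) := by
  rw [real_inner_self_eq_norm_sq] at hunit ⊢
  have hcs : (a * b) ^ 2 ≤ (‖n‖ * ‖v‖) ^ 2 := by
    rw [← sub_eq_zero.1 horth]
    exact sq_le_sq' (neg_le_of_abs_le (abs_real_inner_le_norm n v)) (real_inner_le_norm n v)
  have ha : a * a = 1 + ‖n‖ ^ 2 := by linarith
  rw [mul_sub, ← ha]
  nlinarith

theorem norm_le_sqrt_inducedMetric_graphMap {u : M → ℝ} {x : M}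
    (hu : MDifferentiableAt 𝓘(ℝ, E) 𝓘(ℝ, ℝ) u x)
    {ν : ∀ x : M, TangentProd E (graphMap u x)}
    (hν : IsFutureUnitNormal (E := E) (E' := E) (graphMap u) ν) (v : TangentSpace 𝓘(ℝ, E) x) :
    ‖v‖ ≤ √(1 + ‖projM (graphMap u x) (ν x)‖ ^ 2) *
      √(inducedMetric (E := E) (E' := E) (graphMap u) x v v) := by
  have hn := hν.normal x v
  rw [lorentz, projM_differential_graphMap hu] at hn
  rw [inducedMetric_graphMap_self hu, ← Real.sqrt_mul (by positivity)]
  exact Real.le_sqrt_of_sq_le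
    (norm_sq_le_of_unit_timelike_orthogonal (V := TangentSpace 𝓘(ℝ, E) x) hn (hν.unit x))

end

/-! ### Comparison of distances and completeness -/

section
variable {E : Type*} [NormedAddCommGroup E] [NormedSpace ℝ E]
  {M : Type*} [MetricSpace M] [ChartedSpace E M]
  [RiemannianBundle (fun x : M => TangentSpace 𝓘(ℝ, E) x)]
  [IsRiemannianManifold 𝓘(ℝ, E) M]

theorem metricEDist_le_edist
    {g : ∀ x : M, TangentSpace 𝓘(ℝ, E) x → TangentSpace 𝓘(ℝ, E) x → ℝ}
    (hg : ∀ (x : M) (v : TangentSpace 𝓘(ℝ, E) x), √(g x v v) ≤ ‖v‖) (x y : M) :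
    metricEDist g x y ≤ edist x y := by
  rw [IsRiemannianManifold.out (I := 𝓘(ℝ, E)) x y, metricEDist, Manifold.riemannianEDist,
    Manifold.riemannianEDist]
  refine iInf₂_mono fun γ hγ => lintegral_mono fun t => ?_
  rw [← ofReal_norm]
  exact ENNReal.ofReal_le_ofReal (hg _ _)

variable [IsManifold 𝓘(ℝ, E) 1 M]
  [IsContinuousRiemannianBundle E (fun x : M => TangentSpace 𝓘(ℝ, E) x)]

theorem dist_le_integral_norm_mfderivWithin {γ : ℝ → M}
    (hγ : ContMDiffOn 𝓘(ℝ, ℝ) 𝓘(ℝ, E) 1 γ (Icc 0 1)) {t : ℝ} (ht : t ∈ Icc (0 : ℝ) 1) :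
    dist (γ 0) (γ t) ≤
      ∫ s in (0 : ℝ)..t, ‖mfderivWithin 𝓘(ℝ, ℝ) 𝓘(ℝ, E) γ (Icc 0 1) s (1 : ℝ)‖ := by
  have hcont := continuousOn_norm_mfderivWithin_one hγ (uniqueDiffOn_Icc zero_lt_one)
  have hsub : Icc 0 t ⊆ Icc 0 1 := Icc_subset_Icc_right ht.2
  have h1 := Manifold.riemannianEDist_le_pathELength (hγ.mono hsub) rfl rfl ht.1
  rw [← IsRiemannianManifold.out, Manifold.pathELength_eq_lintegral_mfderiv_Ioo] at h1
  have h2 : edist (γ 0) (γ t) ≤ ∫⁻ s in Ioc 0 t, ENNReal.ofReal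
      ‖mfderivWithin 𝓘(ℝ, ℝ) 𝓘(ℝ, E) γ (Icc 0 1) s (1 : ℝ)‖ := by
    rw [← restrict_Ioo_eq_restrict_Ioc]
    refine h1.trans_eq (setLIntegral_congr_fun measurableSet_Ioo fun s hs => ?_)
    rw [mfderivWithin_of_mem_nhds (Icc_mem_nhds hs.1 (hs.2.trans_le ht.2)), ofReal_norm]
    rfl
  rw [← ofReal_integral_eq_lintegral_ofReal, edist_dist, ENNReal.ofReal_le_ofReal_iff,
    ← intervalIntegral.integral_of_le ht.1] at h2
  · exact h2
  · exact integral_nonneg fun s => norm_nonneg _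
  · exact ((hcont.mono hsub).integrableOn_Icc).mono_set Ioc_subset_Icc_self
  · exact Eventually.of_forall fun s => norm_nonneg _

/-- If `g` dominates `φ (dist o ·)` times the norm and `φ` is nonincreasing, then the integral of
`φ` along the interval of length `dist x y` that starts at `dist o x` bounds the distance of `g`
from below. -/
theorem lintegral_le_metricEDist {o : M} {φ : ℝ → ℝ≥0∞} (hφ : AntitoneOn φ (Ici 0))
    {g : ∀ x : M, TangentSpace 𝓘(ℝ, E) x → TangentSpace 𝓘(ℝ, E) x → ℝ}
    (hg : ∀ (x : M) (v : TangentSpace 𝓘(ℝ, E) x),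
      ENNReal.ofReal ‖v‖ * φ (dist o x) ≤ ENNReal.ofReal √(g x v v)) (x y : M) :
    ∫⁻ s in Icc (dist o x) (dist o x + dist x y), φ s ≤ metricEDist g x y := by
  refine le_of_forall_gt fun r hr => ?_
  rw [metricEDist] at hr
  let _ : ∀ z : M, ENorm (TangentSpace 𝓘(ℝ, E) z) :=
    fun z => ⟨fun v => ENNReal.ofReal (Real.sqrt (g z v v))⟩
  obtain ⟨γ, rfl, rfl, hγ, hlt⟩ := Manifold.exists_lt_of_riemannianEDist_lt hr
  refine lt_of_le_of_lt ?_ hlt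
  rw [Manifold.pathELength_eq_lintegral_mfderivWithin_Icc]
  have hdist := fun t ht => dist_le_integral_norm_mfderivWithin hγ (t := t) ht
  calc ∫⁻ s in Icc (dist o (γ 0)) (dist o (γ 0) + dist (γ 0) (γ 1)), φ s
      ≤ ∫⁻ s in Icc (dist o (γ 0)) (dist o (γ 0) + ∫ t in (0 : ℝ)..1,
          ‖mfderivWithin 𝓘(ℝ, ℝ) 𝓘(ℝ, E) γ (Icc 0 1) t (1 : ℝ)‖), φ s :=
        lintegral_mono_set (Icc_subset_Icc_right (by simpa using hdist 1 (by simp)))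
    _ = _ := lintegral_Icc_add_integral _
        (continuousOn_norm_mfderivWithin_one hγ (uniqueDiffOn_Icc zero_lt_one))
        (fun _ _ => norm_nonneg _) φ _
    _ ≤ _ := by
      refine setLIntegral_mono' measurableSet_Icc fun t ht => ?_
      refine le_trans ?_ (hg (γ t) _)
      refine mul_le_mul_right ?_ _
      -- The point `γ t` is no farther from `o` than `dist o (γ 0)` plus the arc length up to `t`,
      -- where `φ` is evaluated.
      have h1 := dist_triangle o (γ 0) (γ t)
      have h2 := hdist t ht
      have h3 := h1.trans (add_le_add_right h2 _)
      exact hφ dist_nonneg (dist_nonneg.trans h3) h3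

theorem isMetricComplete_of_antitoneOn_mul_norm_le [CompleteSpace M] {o : M} {φ : ℝ → ℝ≥0∞}
    (hφ : AntitoneOn φ (Ici 0)) (hφ0 : φ 0 ≠ ⊤) (hφpos : ∀ t, 0 ≤ t → φ t ≠ 0)
    (hφint : ∫⁻ t in Ici (0 : ℝ), φ t = ⊤)
    {g : ∀ x : M, TangentSpace 𝓘(ℝ, E) x → TangentSpace 𝓘(ℝ, E) x → ℝ}
    (hle : ∀ (x : M) (v : TangentSpace 𝓘(ℝ, E) x), √(g x v v) ≤ ‖v‖)
    (hg : ∀ (x : M) (v : TangentSpace 𝓘(ℝ, E) x),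
      ENNReal.ofReal ‖v‖ * φ (dist o x) ≤ ENNReal.ofReal √(g x v v)) :
    IsMetricComplete g := by
  intro s hs
  have key := lintegral_le_metricEDist hφ hg
  obtain ⟨K, hK⟩ := hs 1 one_pos
  -- Otherwise the integral of `φ` over every `[r, r + k]` would be at most 1, against its
  -- divergence.
  obtain ⟨R, hR⟩ : ∃ R : ℝ, ∀ n ≥ K, dist (s K) (s n) ≤ R := by
    by_contra! hunb
    set r := dist o (s K) with hr
    have h1 : ∀ k : ℕ, ∫⁻ t in Icc r (r + k), φ t ≤ 1 := by
      intro k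
      obtain ⟨n, hn, hkn⟩ := hunb k
      refine (lintegral_mono_set (Icc_subset_Icc_right (by gcongr))).trans
        ((key (s K) (s n)).trans (hK K le_rfl n hn).le)
    have hmono : Monotone fun k : ℕ => Icc r (r + k) := fun a b hab =>
      Icc_subset_Icc_right (by gcongr)
    have hunion : ⋃ k : ℕ, Icc r (r + k) = Ici r := by
      ext t
      simp only [mem_iUnion, mem_Icc, mem_Ici]
      refine ⟨fun ⟨_, h⟩ => h.1, fun h => ?_⟩
      obtain ⟨k, hk⟩ := exists_nat_ge (t - r)
      exact ⟨k, h, by linarith⟩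
    have h2 : ∫⁻ t in Ici r, φ t ≤ 1 := by
      rw [← hunion, setLIntegral_iUnion_of_directed _ hmono.directed_le]
      exact iSup_le h1
    have h3 : ∫⁻ t in Icc 0 r, φ t ≤ φ 0 * ENNReal.ofReal r := by
      refine (setLIntegral_mono' measurableSet_Icc fun t ht =>
        hφ (mem_Ici.2 le_rfl) (mem_Ici.2 ht.1) ht.1).trans_eq ?_
      simp
    have h4 : ∫⁻ t in Ici (0 : ℝ), φ t ≤ φ 0 * ENNReal.ofReal r + 1 := by
      rw [← Icc_union_Ici_eq_Ici (dist_nonneg : 0 ≤ r)]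
      exact (lintegral_union_le _ _ _).trans (add_le_add h3 h2)
    rw [hφint, top_le_iff] at h4
    exact (ENNReal.add_lt_top.2 ⟨ENNReal.mul_lt_top hφ0.lt_top ENNReal.ofReal_lt_top,
      ENNReal.one_lt_top⟩).ne h4
  -- Tail points lie within `dist o (s K) + R` of `o` and within `R + R` of each other, so `φ ≥ φ B`
  -- on the interval of the lower bound.
  set B := dist o (s K) + R + (R + R) with hB
  have hR0 : 0 ≤ R := dist_nonneg.trans (hR K le_rfl)
  have hB0 : 0 ≤ B := by positivity
  have hlow : ∀ m ≥ K, ∀ n ≥ K,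
      φ B * ENNReal.ofReal (dist (s m) (s n)) ≤ metricEDist g (s m) (s n) := by
    intro m hm n hn
    refine le_trans ?_ (key (s m) (s n))
    have hle : dist o (s m) + dist (s m) (s n) ≤ B := by
      have h1 := dist_triangle o (s K) (s m)
      have h2 := dist_triangle_left (s m) (s n) (s K)
      linarith [hR m hm, hR n hn]
    calc φ B * ENNReal.ofReal (dist (s m) (s n))
        = ∫⁻ _ in Icc (dist o (s m)) (dist o (s m) + dist (s m) (s n)), φ B := by simp
      _ ≤ _ := setLIntegral_mono' measurableSet_Icc fun t ht =>
          hφ (dist_nonneg.trans ht.1) hB0 (ht.2.trans hle)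
  have hcauchy : CauchySeq s := by
    rw [Metric.cauchySeq_iff]
    intro ε hε
    obtain ⟨K', hK'⟩ := hs (φ B * ENNReal.ofReal ε)
      (ENNReal.mul_pos (hφpos B hB0) (ENNReal.ofReal_pos.2 hε).ne')
    refine ⟨max K K', fun m hm n hn => ?_⟩
    by_contra! hfar
    refine (hK' m (le_of_max_le_right hm) n (le_of_max_le_right hn)).not_ge
      (le_trans ?_ (hlow m (le_of_max_le_left hm) n (le_of_max_le_left hn)))
    gcongr
  obtain ⟨x, hx⟩ := cauchySeq_tendsto_of_complete hcauchy
  exact ⟨x, tendsto_of_tendsto_of_tendsto_of_le_of_le tendsto_const_nhds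
    (tendsto_iff_edist_tendsto_0.1 hx) (fun _ => zero_le)
    fun n => metricEDist_le_edist hle (s n) x⟩

end

end LorentzProduct

theorem corollary3p5
    {E : Type*} [NormedAddCommGroup E] [NormedSpace ℝ E] [FiniteDimensional ℝ E]
    -- `(M, g_M)` is a (connected) complete smooth Riemannian manifold; `dist` is its distance
    {M : Type*} [MetricSpace M] [ChartedSpace E M] [IsManifold 𝓘(ℝ, E) ∞ M]
    [RiemannianBundle (fun x : M => TangentSpace 𝓘(ℝ, E) x)]
    [IsContMDiffRiemannianBundle 𝓘(ℝ, E) ∞ E (fun x : M => TangentSpace 𝓘(ℝ, E) x)]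
    [IsRiemannianManifold 𝓘(ℝ, E) M] [CompleteSpace M]
    -- the graph of `u` is a spacelike hypersurface of `(M × ℝ, g_M - dt²)` with unit normal `ν`
    (u : M → ℝ) (hu : ContMDiff 𝓘(ℝ, E) 𝓘(ℝ, ℝ) ∞ u)
    (hspace : LorentzProduct.IsSpacelike (E := E) (E' := E) (LorentzProduct.graphMap u))
    (ν : ∀ x : M, LorentzProduct.TangentProd E (LorentzProduct.graphMap u x))
    (hν : LorentzProduct.IsFutureUnitNormal (E := E) (E' := E) (LorentzProduct.graphMap u) ν)
    (G : ℝ → ℝ) (hGcont : ContinuousOn G (Ici 0)) (hGpos : ∀ t, 0 ≤ t → 0 < G t)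
    (hGint : ∫⁻ t in Ici (0 : ℝ), ENNReal.ofReal (1 / G t) = ⊤)
    (hGmono : MonotoneOn G (Ici 0))
    (o : M)
    (hbound : ∀ x : M, ‖LorentzProduct.projM (LorentzProduct.graphMap u x) (ν x)‖ ≤ G (dist o x)) :
    -- the graph with the induced metric is complete
    LorentzProduct.IsMetricComplete
      (LorentzProduct.inducedMetric (E := E) (E' := E) (LorentzProduct.graphMap u)) := by
  have hG0 : 0 < G 0 := hGpos 0 le_rfl
  -- Monotonicity gives $1 \le G(t)^2/G(0)^2$, which absorbs the 1 in $\sqrt{1+G^2}$.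
  set C : ℝ := √(1 + (G 0 ^ 2)⁻¹) with hC
  have hC0 : 0 < C := Real.sqrt_pos.2 (by positivity)
  have hCG : ∀ t, 0 ≤ t → √(1 + G t ^ 2) ≤ C * G t := by
    intro t ht
    have h0t : G 0 ≤ G t := hGmono (mem_Ici.2 le_rfl) ht ht
    rw [← Real.sqrt_sq (hGpos t ht).le, hC, ← Real.sqrt_mul (by positivity),
      Real.sqrt_sq (hGpos t ht).le]
    apply Real.sqrt_le_sqrt
    have h1 : 1 ≤ (G 0 ^ 2)⁻¹ * G t ^ 2 := by
      rw [inv_mul_eq_div, one_le_div (by positivity)]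
      gcongr
    linarith
  have hdiff : ∀ x, MDifferentiableAt 𝓘(ℝ, E) 𝓘(ℝ, ℝ) u x :=
    hu.mdifferentiable (by simp)
  have : IsContinuousRiemannianBundle E (fun x : M => TangentSpace 𝓘(ℝ, E) x) := by
    obtain ⟨g, hg, hg'⟩ := IsContMDiffRiemannianBundle.exists_contMDiff (IB := 𝓘(ℝ, E)) (n := ∞)
      (F := E) (E := fun x : M => TangentSpace 𝓘(ℝ, E) x)
    exact ⟨g, hg.continuous, hg'⟩
  refine LorentzProduct.isMetricComplete_of_antitoneOn_mul_norm_le (o := o)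
    (φ := fun t => ENNReal.ofReal C⁻¹ * ENNReal.ofReal (1 / G t)) ?_ ?_ ?_ ?_
    (fun x v => LorentzProduct.sqrt_inducedMetric_graphMap_le_norm (hdiff x) v) ?_
  · intro a ha b hb hab
    have hGa := hGpos a ha
    have hGab := hGmono ha hb hab
    dsimp only
    gcongr
  · exact ENNReal.mul_ne_top ENNReal.ofReal_ne_top ENNReal.ofReal_ne_top
  · intro t ht
    exact mul_ne_zero (ENNReal.ofReal_pos.2 (by positivity)).ne'
      (ENNReal.ofReal_pos.2 (one_div_pos.2 (hGpos t ht))).ne'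
  · rw [lintegral_const_mul' _ _ ENNReal.ofReal_ne_top, hGint]
    exact ENNReal.mul_top (ENNReal.ofReal_pos.2 (by positivity)).ne'
  · intro x v
    have hGx := hGpos (dist o x) dist_nonneg
    rw [← ENNReal.ofReal_mul (by positivity), ← ENNReal.ofReal_mul (norm_nonneg v)]
    apply ENNReal.ofReal_le_ofReal
    have h1 : ‖v‖ ≤ (C * G (dist o x)) *
        √(LorentzProduct.inducedMetric (E := E) (E' := E) (LorentzProduct.graphMap u) x v v) := by
      refine (LorentzProduct.norm_le_sqrt_inducedMetric_graphMap (hdiff x) hν v).trans ?_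
      gcongr
      refine le_trans (Real.sqrt_le_sqrt ?_) (hCG _ dist_nonneg)
      gcongr
      exact hbound x
    rw [one_div, ← mul_inv, ← div_eq_mul_inv, div_le_iff₀ (by positivity), mul_comm]
    exact h1
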